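/- Let $M$ be a compact $C^\infty$ manifold without boundary, of dimension $n\ge 1$, with a smooth Riemannian metric and the induced distance $d$ (if $M$ is not connected, $d=\infty$ between different components). Let $0<\theta\le 1$ and let $f:M\to M$ be a $C^{1+\theta}$ expanding endomorphism: $f$ is $C^1$, its derivative is locally $\theta$-Hölder in charts, and there are $C>0$, $\sigma>1$ with $\|D_x(f^m)v\|\ge C\sigma^m\|v\|$ for all $m\ge 0$, $x\in M$, $v\in T_xM$. No conformality of $f$ is assumed. For $y\in M$ put $E(f,y)=\{z\in M:\ y\notin\overline{\{f^k(z):k=0,1,2,\dots\}}\}$. *Tilings.* Let $\epsilon>0$. A family $\mathcal T$ of $f$-induced $\epsilon$-tilings of $M$ consists, for each integer $n\ge 1$, of finitely many pairwise disjoint open connected sets $D_n^1,\dots,D_n^{k_n}\subset M$ (the $n$-atoms) with $M=\bigcup_i\overline{D_n^i}$, such that each $D_n^i$ contains a point $x_n^i$ with $$\{p: d(p,f^n(x_n^i))<\epsilon/2\}\subset f^n(D_n^i)\subset\{p: d(p,f^n(x_n^i))\le\epsilon\}.$$ Let $\Omega$ be the set of pairs $(z,n)$ with $n\ge1$ and $z$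 in some $n$-atom, and let $\psi(z,n)$ be the closure of the $n$-atom containing $z$. Call an integer $a_*\ge 1$ *admissible* for $\mathcal T$ if for every $(z,n)\in\Omega$ and every $m>a_*$ there is $z'$ with $(z',n+m)\in\Omega$ and $\psi(z',n+m)\subset\psi(z,n)$. *Game.* Let $a_*$ be admissible, $a,b>a_*$, and $S\subset M$. In the modified Schmidt $(a,b)$-game induced by $f$ (on $\mathcal T$), Bob first chooses any $\omega_1=(z_1,n_1)\in\Omega$; in turn $k$ Alice answers Bob's choice $\omega_k=(z_k,n_k)$ with $\omega_k'=(z_k',n_k')\in\Omega$ such that $n_k'=n_k+a$ and $\psi(\omega_k')\subset\psi(\omega_k)$, and then Bob chooses $\omega_{k+1}=(z_{k+1},n_{k+1})\in\Omega$ with $n_{k+1}=n_k'+b$ and $\psi(\omega_{k+1})\subset\psi(\omega_k')$. Alice wins if $\bigcap_k\psi(\omega_k)\cap\psi(\omega_k')$ consists of exactly one point and this point lies in $S$. The set $S$ is $(a,b)$-winning if Alice has a strategy that wins against every legal play of Bob, $a$-winning if it is $(a,b)$-winning for every $b>a_*$, and winning (with respect to $a_*$) if it is $a$-winning for some $a>a_*$.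 **Theorem.** There is $\epsilon_0>0$ (depending only on $M$ and $f$) such that for every $0<\epsilon<\epsilon_0$ and every family $\mathcal T$ of $f$-induced $\epsilon$-tilings of $M$: an admissible $a_*$ exists, and for every admissible $a_*$ and every $y\in M$ the set $E(f,y)$ is winning with respect to $a_*$ for the modified Schmidt games induced by $f$ and played on $\mathcal T$. -/

import Mathlib

open scoped Bundle Manifold ContDiff NNReal

noncomputable section

/-- `f` is of class `C^{1+θ}`: it is `C^1`, and around every point its derivative, read in the
charts of `M`, is Hölder continuous with exponent `θ`. (It is meant for `0 < θ ≤ 1`. Then, as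
changes of charts are smooth, it does not depend on the charts.) -/
def IsC1Holder {n : ℕ} {M : Type*} [TopologicalSpace M]
    [ChartedSpace (EuclideanSpace ℝ (Fin n)) M] (θ : ℝ≥0) (f : M → M) : Prop :=
  ContMDiff (𝓡 n) (𝓡 n) 1 f ∧
    ∀ x : M, ∃ C : ℝ≥0, ∃ s ∈ nhds (extChartAt (𝓡 n) x x),
      HolderOnWith C θ (fderiv ℝ (writtenInExtChartAt (𝓡 n) (𝓡 n) x f)) s

/-- `f` is expanding for the Riemannian metric of `M`: there are `C > 0` and `σ > 1` with
`‖D_x(f^m) v‖ ≥ C σ^m ‖v‖` for every `m`, every point `x` and every tangent vector `v` at `x`. -/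
def IsExpanding {n : ℕ} {M : Type*} [TopologicalSpace M]
    [ChartedSpace (EuclideanSpace ℝ (Fin n)) M]
    [Bundle.RiemannianBundle (fun x : M => TangentSpace (𝓡 n) x)] (f : M → M) : Prop :=
  ∃ C : ℝ, 0 < C ∧ ∃ σ : ℝ, 1 < σ ∧
    ∀ (m : ℕ) (x : M) (v : TangentSpace (𝓡 n) x),
      C * σ ^ m * ‖v‖ ≤ ‖mfderiv (𝓡 n) (𝓡 n) (f^[m]) x v‖

/-- `E(f, y)`: the points `z` such that `y` is not in the closure of the forward orbit
`{f^k z : k = 0, 1, 2, …}`. -/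
def avoidingSet {M : Type*} [TopologicalSpace M] (f : M → M) (y : M) : Set M :=
  {z | y ∉ closure (Set.range fun k : ℕ => f^[k] z)}

/-- A family of `f`-induced `ε`-tilings: for each `n ≥ 1` finitely many pairwise disjoint open
connected sets, the `n`-atoms, whose closures cover `M` and whose images under `f^n` contain a ball
of radius `ε / 2` and lie in the ball of radius `ε` with the same center, the center being the
image of a point of the atom. (Only the values at `n ≥ 1` matter. The inner ball is open and the
outer ball is closed: this is the weakest form of the condition, implied by the one with both balls
closed and by the one with both balls open.) -/
structure InducedTiling {M : Type*} [EMetricSpace M] (f : M → M) (ε : ℝ) where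
  /-- the number of `n`-atoms -/
  numAtoms : ℕ → ℕ
  /-- the `n`-atoms -/
  atom : (n : ℕ) → Fin (numAtoms n) → Set M
  isOpen_atom : ∀ n, 1 ≤ n → ∀ i, IsOpen (atom n i)
  isConnected_atom : ∀ n, 1 ≤ n → ∀ i, IsConnected (atom n i)
  exists_center : ∀ n, 1 ≤ n → ∀ i, ∃ x ∈ atom n i,
    Metric.eball (f^[n] x) (ENNReal.ofReal (ε / 2)) ⊆ f^[n] '' atom n i ∧
      f^[n] '' atom n i ⊆ Metric.closedEBall (f^[n] x) (ENNReal.ofReal ε)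
  disjoint_atom : ∀ n, 1 ≤ n → ∀ i j, i ≠ j → Disjoint (atom n i) (atom n j)
  cover : ∀ n, 1 ≤ n → ⋃ i, closure (atom n i) = Set.univ

namespace InducedTiling

variable {M : Type*} [EMetricSpace M] {f : M → M} {ε : ℝ}

/-- `Ω`: the pairs `(z, n)` with `n ≥ 1` and `z` in some (hence exactly one) `n`-atom. -/
def pairs (T : InducedTiling f ε) : Set (M × ℕ) :=
  {w | 1 ≤ w.2 ∧ ∃ i, w.1 ∈ T.atom w.2 i}

/-- `ψ(z, n)`: the closure of the `n`-atom that contains `z`. -/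
def psi (T : InducedTiling f ε) (w : M × ℕ) : Set M :=
  closure (⋃ i, ⋃ _ : w.1 ∈ T.atom w.2 i, T.atom w.2 i)

/-- The positive integer `aStar` has the property that makes the game playable: for every
`(z, n) ∈ Ω` and every `m > aStar` there is `(z', n + m) ∈ Ω` with `ψ(z', n + m) ⊆ ψ(z, n)`. -/
def IsThreshold (T : InducedTiling f ε) (aStar : ℕ) : Prop :=
  1 ≤ aStar ∧ ∀ w ∈ T.pairs, ∀ m, aStar < m →
    ∃ z' : M, (z', w.2 + m) ∈ T.pairs ∧ T.psi (z', w.2 + m) ⊆ T.psi w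

/-- Alice's choice in turn `k` (turns are numbered from `0`), when she follows the strategy
`strat` and Bob's choices are `w 0, w 1, …`: the strategy sees Bob's choices up to turn `k`
(Alice's own earlier choices are determined by these). -/
def aliceMove (strat : List (M × ℕ) → M × ℕ) (w : ℕ → M × ℕ) (k : ℕ) : M × ℕ :=
  strat ((List.range (k + 1)).map w)

/-- Bob's choice in turn `k` obeys the rules of the `(a, b)`-game: his first choice is any element
of `Ω`; later he goes `b` levels down from Alice's last choice and stays inside it. -/
def BobLegal (T : InducedTiling f ε) (b : ℕ) (strat : List (M × ℕ) → M × ℕ)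
    (w : ℕ → M × ℕ) : ℕ → Prop
  | 0 => w 0 ∈ T.pairs
  | k + 1 => w (k + 1) ∈ T.pairs ∧ (w (k + 1)).2 = (aliceMove strat w k).2 + b ∧
      T.psi (w (k + 1)) ⊆ T.psi (aliceMove strat w k)

/-- Alice's choice in turn `k` obeys the rules of the `(a, b)`-game: she goes `a` levels down from
Bob's last choice and stays inside it. -/
def AliceLegal (T : InducedTiling f ε) (a : ℕ) (strat : List (M × ℕ) → M × ℕ)
    (w : ℕ → M × ℕ) (k : ℕ) : Prop :=
  aliceMove strat w k ∈ T.pairs ∧ (aliceMove strat w k).2 = (w k).2 + a ∧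
    T.psi (aliceMove strat w k) ⊆ T.psi (w k)

/-- `strat` is an `(a, b; S)`-winning strategy for Alice: as long as Bob plays by the rules, so
does Alice, and whenever Bob plays by the rules forever, the chosen sets `ψ` intersect in exactly
one point, and this point is in `S`. -/
def IsWinningStrategy (T : InducedTiling f ε) (a b : ℕ) (S : Set M)
    (strat : List (M × ℕ) → M × ℕ) : Prop :=
  (∀ (w : ℕ → M × ℕ) (k : ℕ), (∀ j ≤ k, T.BobLegal b strat w j) → T.AliceLegal a strat w k) ∧
  ∀ w : ℕ → M × ℕ, (∀ k, T.BobLegal b strat w k) →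
    ∃ z ∈ S, ⋂ k, (T.psi (w k) ∩ T.psi (aliceMove strat w k)) = {z}

/-- `S` is an `(a, b)`-winning set for the modified Schmidt game on the tilings `T`. -/
def IsWinningFor (T : InducedTiling f ε) (a b : ℕ) (S : Set M) : Prop :=
  ∃ strat : List (M × ℕ) → M × ℕ, T.IsWinningStrategy a b S strat

/-- `S` is a winning set: for some `a > aStar` it is `a`-winning, that is, `(a, b)`-winning for
every `b > aStar`. -/
def IsWinning (T : InducedTiling f ε) (aStar : ℕ) (S : Set M) : Prop :=
  ∃ a, aStar < a ∧ ∀ b, aStar < b → T.IsWinningFor a b S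

end InducedTiling

end

/-! Alice keeps the orbit out of one fixed ball around `y`. The difficulty is that `a` must be
chosen before `b`, whereas between two of her moves the orbit may visit `y` a number of times that
grows with `b`.

Expansion is used through one metric fact, `exists_inverseContracts`: a connected set with small
image under `f^i` is smaller than that image by a factor `κ i → 0`. It follows from the derivative
bound by charts and compactness. Hence `f^n` is injective on each `n`-cell, and Alice can steer the
image of a cell towards any target in a fixed ball (`exists_subcell`).

For a cell of level `n`, a visit of age `i` is a point of the cell whose image under `f^(n-i)` is
`δ`-close to `y`. If all ages are at most `J`, a small `δ` makes all visits of the same age nearly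
coincide under `f^n`. Let `I` be the largest age, and consider ages above `J/2`. Those in `(I - m₀,
I]` give at most `m₀` small spots. All the others lie in one small cluster, whatever their number:
the visits of age `I`, `i` and `i'` shadow each other, and this forces the images of the last two
together (`edist_le_of_isAlive`). So Alice avoids one cluster and `m₀` spots with an `a` independent
of `J` (`exists_reply`).

Her reply thus removes every age above `J/2`. A full turn adds `a + b ≤ J/2` to the ages, so they
never exceed `J`. In the limit point a visit at a fixed time would have unbounded age, so there is
none. -/

/-! ### Charts are locally bi-Lipschitz for the Riemannian distance -/

section Charts

open Set Filter MeasureTheory Manifold Metric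
open scoped Topology ENNReal

attribute [local instance] normedAddCommGroupTangentSpaceVectorSpace
attribute [local instance] normedSpaceTangentSpaceVectorSpace

variable {n : ℕ} {M : Type*} [EMetricSpace M]
    [ChartedSpace (EuclideanSpace ℝ (Fin n)) M] [IsManifold (𝓡 n) 1 M]
    [Bundle.RiemannianBundle (fun x : M => TangentSpace (𝓡 n) x)]
    [IsContinuousRiemannianBundle (EuclideanSpace ℝ (Fin n))
      (fun x : M => TangentSpace (𝓡 n) x)]

/-- The derivative of a chart, as a map with values in the model space. -/
noncomputable def chartDeriv (x₀ y : M) (v : TangentSpace (𝓡 n) y) : EuclideanSpace ℝ (Fin n) :=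
  mfderiv (𝓡 n) 𝓘(ℝ, EuclideanSpace ℝ (Fin n)) (extChartAt (𝓡 n) x₀) y v

lemma eventually_norm_chartDeriv_le (x₀ : M) :
    ∃ C : ℝ≥0, ∀ᶠ y in 𝓝 x₀, ∀ v : TangentSpace (𝓡 n) y, ‖chartDeriv x₀ y v‖ ≤ C * ‖v‖ := by
  obtain ⟨C, hC, h⟩ := eventually_norm_mfderiv_extChartAt_lt (𝓡 n) x₀
  refine ⟨⟨C, hC.le⟩, ?_⟩
  filter_upwards [h] with y hy v
  exact (ContinuousLinearMap.le_opNorm _ v).trans (mul_le_mul_of_nonneg_right hy.le (norm_nonneg v))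

/-- The derivative of the inverse of a chart, on vectors of the model space. -/
noncomputable def chartSymmDeriv (x₀ : M) (e v : EuclideanSpace ℝ (Fin n)) :
    TangentSpace (𝓡 n) ((extChartAt (𝓡 n) x₀).symm e) :=
  mfderivWithin 𝓘(ℝ, EuclideanSpace ℝ (Fin n)) (𝓡 n) (extChartAt (𝓡 n) x₀).symm
    (range (𝓡 n)) e v

lemma eventually_norm_chartSymmDeriv_le (x₀ : M) :
    ∃ C : ℝ≥0, ∀ᶠ e in 𝓝 (extChartAt (𝓡 n) x₀ x₀), ∀ v : EuclideanSpace ℝ (Fin n),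
      ‖chartSymmDeriv x₀ e v‖ ≤ C * ‖v‖ := by
  obtain ⟨C, hC, h⟩ := eventually_norm_mfderivWithin_symm_extChartAt_lt (𝓡 n) x₀
  refine ⟨⟨C, hC.le⟩, ?_⟩
  have : 𝓝[range (𝓡 n)] (extChartAt (𝓡 n) x₀ x₀) = 𝓝 (extChartAt (𝓡 n) x₀ x₀) := by
    rw [ModelWithCorners.range_eq_univ, nhdsWithin_univ]
  rw [this] at h
  filter_upwards [h] with e he v
  exact (ContinuousLinearMap.le_opNorm _ _).trans
    (mul_le_mul_of_nonneg_right he.le (norm_nonneg v))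

lemma eventually_norm_le_chartDeriv (x₀ : M) :
    ∃ C : ℝ≥0, ∀ᶠ y in 𝓝 x₀, ∀ v : TangentSpace (𝓡 n) y, ‖v‖ ≤ C * ‖chartDeriv x₀ y v‖ := by
  obtain ⟨C, h⟩ := eventually_norm_chartSymmDeriv_le (n := n) x₀
  refine ⟨C, ?_⟩
  filter_upwards [(continuousAt_extChartAt x₀).eventually h,
    extChartAt_source_mem_nhds (I := 𝓡 n) x₀] with y hy hys v
  obtain ⟨e, he, rfl⟩ : ∃ e ∈ (extChartAt (𝓡 n) x₀).target, y = (extChartAt (𝓡 n) x₀).symm e :=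
    ⟨_, (extChartAt (𝓡 n) x₀).map_source hys, ((extChartAt (𝓡 n) x₀).left_inv hys).symm⟩
  rw [(extChartAt (𝓡 n) x₀).right_inv he] at hy
  have h1 := mfderivWithin_extChartAt_symm_comp_mfderiv_extChartAt (I := 𝓡 n) he
  have h2 : chartSymmDeriv x₀ e (chartDeriv x₀ _ v) = v := congr($h1 v)
  have h3 := hy (chartDeriv x₀ _ v)
  rwa [h2] at h3

lemma enorm_le_of_norm_le {E F : Type*} [NormedAddCommGroup E] [NormedAddCommGroup F] {x : E}
    {y : F} {C : ℝ≥0} (h : ‖x‖ ≤ C * ‖y‖) : ‖x‖ₑ ≤ C * ‖y‖ₑ := by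
  rw [← ofReal_norm, ← ofReal_norm, ← ENNReal.ofReal_coe_nnreal, ← ENNReal.ofReal_mul C.coe_nonneg]
  exact ENNReal.ofReal_le_ofReal h

variable [IsRiemannianManifold (𝓡 n) M]

/-- The coordinate segment pulled back to `M` is a competitor for the Riemannian distance; its
length is controlled by the derivative of the inverse chart. -/
lemma eventually_edist_le_edist_extChartAt (x₀ : M) :
    ∃ C : ℝ≥0, ∀ᶠ p in 𝓝 x₀ ×ˢ 𝓝 x₀,
      edist p.1 p.2 ≤ C * edist (extChartAt (𝓡 n) x₀ p.1) (extChartAt (𝓡 n) x₀ p.2) := by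
  rcases eventually_norm_chartSymmDeriv_le (n := n) x₀ with ⟨C, hC⟩
  refine ⟨C, ?_⟩
  obtain ⟨r, r_pos, hr⟩ : ∃ r > 0,
      ball (extChartAt (𝓡 n) x₀ x₀) r ⊆ (extChartAt (𝓡 n) x₀).target ∩
        {e | ∀ v : EuclideanSpace ℝ (Fin n), ‖chartSymmDeriv x₀ e v‖ ≤ C * ‖v‖} :=
    mem_nhds_iff.1 (inter_mem (extChartAt_target_mem_nhds x₀) hC)
  have A : (extChartAt (𝓡 n) x₀) ⁻¹' (ball (extChartAt (𝓡 n) x₀ x₀) r) ∩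
      (extChartAt (𝓡 n) x₀).source ∈ 𝓝 x₀ :=
    inter_mem ((continuousAt_extChartAt x₀).preimage_mem_nhds (ball_mem_nhds _ r_pos))
      (extChartAt_source_mem_nhds x₀)
  filter_upwards [prod_mem_prod A A]
  rintro ⟨y, z⟩ ⟨⟨hy, hys⟩, ⟨hz, hzs⟩⟩
  simp only
  let η := ContinuousAffineMap.lineMap (R := ℝ) (extChartAt (𝓡 n) x₀ y) (extChartAt (𝓡 n) x₀ z)
  set γ := (extChartAt (𝓡 n) x₀).symm ∘ η
  have hη : Icc 0 1 ⊆ ⇑η ⁻¹' ((extChartAt (𝓡 n) x₀).target ∩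
        {e | ∀ v : EuclideanSpace ℝ (Fin n), ‖chartSymmDeriv x₀ e v‖ ≤ C * ‖v‖}) := by
    simp only [← image_subset_iff, ContinuousAffineMap.coe_lineMap_eq,
     ← segment_eq_image_lineMap, η]
    refine Subset.trans ?_ hr
    exact (convex_ball _ _).segment_subset hy hz
  simp only [preimage_inter, subset_inter_iff] at hη
  have η_smooth : ContMDiffOn 𝓘(ℝ) 𝓘(ℝ, EuclideanSpace ℝ (Fin n)) 1 η (Icc 0 1) := by
    apply ContMDiff.contMDiffOn
    rw [contMDiff_iff_contDiff]
    exact ContinuousAffineMap.contDiff _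
  have : edist y z ≤ pathELength (𝓡 n) γ 0 1 := by
    rw [IsRiemannianManifold.out (I := 𝓡 n) y z]
    apply riemannianEDist_le_pathELength _ _ _ zero_le_one
    · exact (contMDiffOn_extChartAt_symm x₀).comp η_smooth hη.1
    · simp only [γ, η, Function.comp_apply, ContinuousAffineMap.coe_lineMap_eq,
        AffineMap.lineMap_apply_zero]
      exact (extChartAt (𝓡 n) x₀).left_inv hys
    · simp only [γ, η, Function.comp_apply, ContinuousAffineMap.coe_lineMap_eq,
        AffineMap.lineMap_apply_one]
      exact (extChartAt (𝓡 n) x₀).left_inv hzs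
  apply this.trans
  rw [← lintegral_fderiv_lineMap_eq_edist, pathELength_eq_lintegral_mfderivWithin_Icc,
    ← lintegral_const_mul' _ _ ENNReal.coe_ne_top]
  apply setLIntegral_mono' measurableSet_Icc (fun t ht ↦ ?_)
  have : mfderivWithin 𝓘(ℝ) (𝓡 n) γ (Icc 0 1) t =
      (mfderivWithin 𝓘(ℝ, EuclideanSpace ℝ (Fin n)) (𝓡 n) (extChartAt (𝓡 n) x₀).symm
        (range (𝓡 n)) (η t)) ∘L
        (mfderivWithin 𝓘(ℝ) 𝓘(ℝ, EuclideanSpace ℝ (Fin n)) η (Icc 0 1) t) := by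
    apply mfderivWithin_comp
    · exact mdifferentiableWithinAt_extChartAt_symm (hη.1 ht)
    · exact η_smooth.mdifferentiableOn one_ne_zero t ht
    · exact hη.1.trans (preimage_mono (extChartAt_target_subset_range x₀))
    · rw [uniqueMDiffWithinAt_iff_uniqueDiffWithinAt]
      exact uniqueDiffOn_Icc zero_lt_one t ht
  have : mfderivWithin 𝓘(ℝ) (𝓡 n) γ (Icc 0 1) t 1 = chartSymmDeriv x₀ (η t)
        (fderivWithin ℝ η (Icc 0 1) t 1) := by
    rw [this, mfderivWithin_eq_fderivWithin]
    rfl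
  rw [this]
  exact enorm_le_of_norm_le (hη.2 ht _)

/-- An almost shortest curve between points close to `x₀` cannot leave the region where the chart
derivative is bounded, so that bound can be integrated along it. -/
lemma eventually_edist_extChartAt_le_edist (x₀ : M) :
    ∃ C : ℝ≥0, ∀ᶠ p in 𝓝 x₀ ×ˢ 𝓝 x₀,
      edist (extChartAt (𝓡 n) x₀ p.1) (extChartAt (𝓡 n) x₀ p.2) ≤ C * edist p.1 p.2 := by
  rcases eventually_norm_chartDeriv_le (n := n) x₀ with ⟨C, hC⟩
  refine ⟨C, ?_⟩
  obtain ⟨r, r_pos, hr⟩ := EMetric.mem_nhds_iff.1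
    (inter_mem hC (extChartAt_source_mem_nhds (I := 𝓡 n) x₀))
  -- Endpoints within `r / 3` of `x₀` and a curve shorter than `2r / 3` keep the whole curve in the
  -- `r`-ball.
  have r3 : 0 < r / 3 := ENNReal.div_pos r_pos.ne' (by simp)
  have A : eball x₀ (r / 3) ∈ 𝓝 x₀ := eball_mem_nhds _ r3
  filter_upwards [prod_mem_prod A A]
  rintro ⟨y, z⟩ ⟨hy, hz⟩
  simp only
  have hyz : edist y z < r / 3 + r / 3 :=
    (edist_triangle_right y z x₀).trans_lt (ENNReal.add_lt_add hy hz)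
  have key : ∀ d, edist y z < d →
      edist (extChartAt (𝓡 n) x₀ y) (extChartAt (𝓡 n) x₀ z) ≤ C * d := by
    intro d hd
    have hd' : edist y z < min d (r / 3 + r / 3) := lt_min hd hyz
    rw [IsRiemannianManifold.out (I := 𝓡 n) y z] at hd'
    obtain ⟨γ, hγy, hγz, hγ, hlen⟩ := exists_lt_of_riemannianEDist_lt hd'
    have hmem : ∀ t ∈ Icc (0:ℝ) 1, γ t ∈ eball x₀ r := by
      intro t ht
      have h1 : edist (γ 0) (γ t) ≤ pathELength (𝓡 n) γ 0 1 := by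
        rw [IsRiemannianManifold.out (I := 𝓡 n) (γ 0) (γ t)]
        exact (riemannianEDist_le_pathELength (hγ.mono (Icc_subset_Icc_right ht.2)) rfl rfl
          ht.1).trans (pathELength_mono le_rfl ht.2)
      have h2 := h1.trans_lt (hlen.trans_le (min_le_right _ _))
      rw [hγy, edist_comm] at h2
      calc edist (γ t) x₀ ≤ edist (γ t) y + edist y x₀ := edist_triangle _ _ _
        _ < r / 3 + r / 3 + r / 3 := ENNReal.add_lt_add h2 hy
        _ = r := ENNReal.add_thirds r
    let γ' := extChartAt (𝓡 n) x₀ ∘ γ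
    have hγ' : ContMDiffOn 𝓘(ℝ) 𝓘(ℝ, EuclideanSpace ℝ (Fin n)) 1 γ' (Icc 0 1) :=
      contMDiffOn_extChartAt.comp (I' := 𝓡 n) (t := (chartAt (EuclideanSpace ℝ (Fin n)) x₀).source)
        hγ (fun t ht ↦ by simpa using (hr (hmem t ht)).2)
    rw [edist_comm, edist_eq_enorm_sub]
    calc
      _ = ‖γ' 1 - γ' 0‖ₑ := by simp only [γ', Function.comp_apply, hγy, hγz]
      _ ≤ ∫⁻ t in Icc 0 1, ‖derivWithin γ' (Icc 0 1) t‖ₑ := by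
        apply enorm_sub_le_lintegral_derivWithin_Icc_of_contDiffOn_Icc _ zero_le_one
        rwa [← contMDiffOn_iff_contDiffOn]
      _ ≤ ∫⁻ t in Icc 0 1, C * ‖mfderivWithin 𝓘(ℝ) (𝓡 n) γ (Icc 0 1) t 1‖ₑ := by
        apply setLIntegral_mono' measurableSet_Icc (fun t ht ↦ ?_)
        have : mfderivWithin 𝓘(ℝ) 𝓘(ℝ, EuclideanSpace ℝ (Fin n)) γ' (Icc 0 1) t =
            (mfderiv (𝓡 n) 𝓘(ℝ, EuclideanSpace ℝ (Fin n)) (extChartAt (𝓡 n) x₀) (γ t)) ∘L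
              (mfderivWithin 𝓘(ℝ) (𝓡 n) γ (Icc 0 1) t) := by
          apply mfderiv_comp_mfderivWithin
          · exact mdifferentiableAt_extChartAt (by simpa using (hr (hmem t ht)).2)
          · exact hγ.mdifferentiableOn one_ne_zero _ ht
          · rw [uniqueMDiffWithinAt_iff_uniqueDiffWithinAt]
            exact uniqueDiffOn_Icc zero_lt_one t ht
        have : derivWithin γ' (Icc 0 1) t =
            chartDeriv x₀ (γ t) (mfderivWithin 𝓘(ℝ) (𝓡 n) γ (Icc 0 1) t 1) := by
          rw [← fderivWithin_derivWithin, ← mfderivWithin_eq_fderivWithin, this]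
          rfl
        rw [this]
        exact enorm_le_of_norm_le ((hr (hmem t ht)).1 _)
      _ = C * pathELength (𝓡 n) γ 0 1 := by
        rw [lintegral_const_mul' _ _ ENNReal.coe_ne_top,
          pathELength_eq_lintegral_mfderivWithin_Icc]
      _ ≤ C * d := by
        gcongr
        exact hlen.le.trans (min_le_left _ _)
  rcases eq_or_ne C 0 with rfl | hC0
  · obtain ⟨d, hd, -⟩ := exists_between hyz
    simpa using key _ hd
  · refine (ENNReal.div_le_iff' (by simpa using hC0) ENNReal.coe_ne_top).1
      (le_of_forall_gt_imp_ge_of_dense fun d hd => ?_)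
    exact (ENNReal.div_le_iff' (by simpa using hC0) ENNReal.coe_ne_top).2 (key d hd)

end Charts

/-! ### From the derivative bound to local expansion of distances -/

section LocalExpansion

open Set Filter Manifold Metric
open scoped Topology ENNReal

/-- The linearization error is at most `1 / (2k)` times the distance; after multiplication by `k`
half of the distance is absorbed on the left. -/
lemma HasStrictFDerivAt.eventually_norm_sub_le {E F : Type*} [NormedAddCommGroup E]
    [NormedSpace ℝ E] [NormedAddCommGroup F] [NormedSpace ℝ F] {g : E → F} {g' : E →L[ℝ] F} {e : E}
    (hg : HasStrictFDerivAt g g' e) {k : ℝ} (hk : 0 < k) (h : ∀ u, ‖u‖ ≤ k * ‖g' u‖) :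
    ∀ᶠ p in 𝓝 e ×ˢ 𝓝 e, ‖p.1 - p.2‖ ≤ 2 * k * ‖g p.1 - g p.2‖ := by
  rw [← nhds_prod_eq]
  filter_upwards [hg.isLittleO.def (show 0 < 1 / (2 * k) by positivity)] with p hp
  have h1 := h (p.1 - p.2)
  have h2 : ‖g' (p.1 - p.2)‖ ≤ ‖g p.1 - g p.2‖ + ‖g p.1 - g p.2 - g' (p.1 - p.2)‖ := by
    have := norm_sub_le (g p.1 - g p.2) (g p.1 - g p.2 - g' (p.1 - p.2))
    simpa using this
  have h3 : k * ‖g' (p.1 - p.2)‖ ≤ k * (‖g p.1 - g p.2‖ + 1 / (2 * k) * ‖p.1 - p.2‖) := by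
    gcongr
    exact h2.trans (by gcongr)
  have h4 : k * (‖g p.1 - g p.2‖ + 1 / (2 * k) * ‖p.1 - p.2‖) =
      k * ‖g p.1 - g p.2‖ + ‖p.1 - p.2‖ / 2 := by
    field_simp
  linarith

/-- A map is locally inverse Lipschitz with constant `K`: it contracts no distance of nearby points
by more than the factor `K`. -/
def LocallyExpands {M : Type*} [EMetricSpace M] (K : ℝ≥0) (F : M → M) : Prop :=
  ∃ ρ : ℝ≥0∞, 0 < ρ ∧ ∀ x y, edist x y < ρ → edist x y ≤ K * edist (F x) (F y)

lemma locallyExpands_of_forall_eventually {M : Type*} [EMetricSpace M] [CompactSpace M] {K : ℝ≥0}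
    {F : M → M}
    (h : ∀ x, ∀ᶠ p in 𝓝 x ×ˢ 𝓝 x, edist p.1 p.2 ≤ K * edist (F p.1) (F p.2)) :
    LocallyExpands K F := by
  have hU : {p : M × M | edist p.1 p.2 ≤ K * edist (F p.1) (F p.2)} ∈ uniformity M := by
    rw [← nhdsSet_diagonal_eq_uniformity, mem_nhdsSet_iff_forall]
    rintro ⟨x, y⟩ hxy
    obtain rfl : x = y := hxy
    rw [nhds_prod_eq]
    exact h x
  obtain ⟨ρ, hρ, hρ'⟩ := mem_uniformity_edist.1 hU
  exact ⟨ρ, hρ, fun x y hxy => hρ' hxy⟩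

variable {n : ℕ} {M : Type*} [EMetricSpace M]
    [ChartedSpace (EuclideanSpace ℝ (Fin n)) M]
    [Bundle.RiemannianBundle (fun x : M => TangentSpace (𝓡 n) x)]

/-- On `U`, the chart at `x₀` and its derivative distort distances and lengths at most by the
factor `C`. -/
structure IsChartBound (x₀ : M) (C : ℝ≥0) (U : Set M) : Prop where
  isOpen : IsOpen U
  subset_source : U ⊆ (extChartAt (𝓡 n) x₀).source
  edist_le : ∀ y ∈ U, ∀ z ∈ U,
    edist y z ≤ C * edist (extChartAt (𝓡 n) x₀ y) (extChartAt (𝓡 n) x₀ z)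
  le_edist : ∀ y ∈ U, ∀ z ∈ U,
    edist (extChartAt (𝓡 n) x₀ y) (extChartAt (𝓡 n) x₀ z) ≤ C * edist y z
  norm_le : ∀ y ∈ U, ∀ v : TangentSpace (𝓡 n) y, ‖v‖ ≤ C * ‖chartDeriv x₀ y v‖
  le_norm : ∀ y ∈ U, ∀ v : TangentSpace (𝓡 n) y, ‖chartDeriv x₀ y v‖ ≤ C * ‖v‖

lemma IsChartBound.mono {x₀ : M} {C C' : ℝ≥0} {U : Set M}
    (h : IsChartBound (n := n) x₀ C U) (hC : C ≤ C') : IsChartBound (n := n) x₀ C' U where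
  isOpen := h.isOpen
  subset_source := h.subset_source
  edist_le y hy z hz := (h.edist_le y hy z hz).trans (by gcongr)
  le_edist y hy z hz := (h.le_edist y hy z hz).trans (by gcongr)
  norm_le y hy v := (h.norm_le y hy v).trans (by gcongr)
  le_norm y hy v := (h.le_norm y hy v).trans (by gcongr)

variable [IsManifold (𝓡 n) 1 M]

/-- In `2 * C ^ 4 / A`, two factors `C` compare tangent norms with coordinate norms, two compare
distances with coordinate distances, and the 2 is the linearization loss. -/
lemma eventually_edist_le_of_mfderiv {F : M → M}
    (hF : ContMDiff (𝓡 n) (𝓡 n) 1 F) {x x₀ x₁ : M} {C : ℝ≥0} (hC : 0 < C) {U V : Set M}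
    (hU : IsChartBound (n := n) x₀ C U) (hV : IsChartBound (n := n) x₁ C V) (hx : x ∈ U)
    (hFx : F x ∈ V) {A : ℝ≥0} (hA : 0 < A)
    (h : ∀ v : TangentSpace (𝓡 n) x, A * ‖v‖ ≤ ‖mfderiv (𝓡 n) (𝓡 n) F x v‖) :
    ∀ᶠ p in 𝓝 x ×ˢ 𝓝 x, edist p.1 p.2 ≤ (2 * C ^ 4 / A : ℝ≥0) * edist (F p.1) (F p.2) := by
  set φ := extChartAt (𝓡 n) x₀ with hφ
  set φ' := extChartAt (𝓡 n) x₁ with hφ'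
  have hxs := hU.subset_source hx
  have hFxs := hV.subset_source hFx
  let g := φ' ∘ F ∘ φ.symm
  have hsymm : φ.symm (φ x) = x := φ.left_inv hxs
  have hg : ContDiffAt ℝ 1 g (φ x) := by
    rw [← contMDiffAt_iff_contDiffAt]
    have h1 : ContMDiffAt 𝓘(ℝ, EuclideanSpace ℝ (Fin n)) (𝓡 n) 1 φ.symm (φ x) :=
      (contMDiffOn_extChartAt_symm x₀).contMDiffAt (extChartAt_target_mem_nhds'
        (φ.map_source hxs))
    have h2 : ContMDiffAt (𝓡 n) 𝓘(ℝ, EuclideanSpace ℝ (Fin n)) 1 φ' (F (φ.symm (φ x))) := by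
      rw [hsymm]
      exact contMDiffAt_extChartAt' (by simpa using hFxs)
    exact h2.comp (φ x) ((hF (φ.symm (φ x))).comp (φ x) h1)
  have hgF : g ∘ φ =ᶠ[𝓝 x] φ' ∘ F := by
    filter_upwards [hU.isOpen.mem_nhds hx] with y hy
    simp [g, φ.left_inv (hU.subset_source hy)]
  have hderiv : ∀ v : TangentSpace (𝓡 n) x,
      fderiv ℝ g (φ x) (chartDeriv x₀ x v) =
        chartDeriv x₁ (F x) (mfderiv (𝓡 n) (𝓡 n) F x v) := by
    have h1 : mfderiv (𝓡 n) 𝓘(ℝ, EuclideanSpace ℝ (Fin n)) (g ∘ φ) x = _ :=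
      mfderiv_comp x (I' := 𝓘(ℝ, EuclideanSpace ℝ (Fin n)))
      (hg.differentiableAt one_ne_zero).mdifferentiableAt
      (mdifferentiableAt_extChartAt (by simpa using hxs))
    have h2 : mfderiv (𝓡 n) 𝓘(ℝ, EuclideanSpace ℝ (Fin n)) (φ' ∘ F) x = _ :=
      mfderiv_comp x (I' := 𝓡 n)
      (mdifferentiableAt_extChartAt (by simpa using hFxs))
      ((hF x).mdifferentiableAt one_ne_zero)
    have h3 := hgF.mfderiv_eq (I := 𝓡 n) (I' := 𝓘(ℝ, EuclideanSpace ℝ (Fin n)))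
    intro v
    have h4 : mfderiv (𝓡 n) 𝓘(ℝ, EuclideanSpace ℝ (Fin n)) (g ∘ φ) x v =
      mfderiv (𝓡 n) 𝓘(ℝ, EuclideanSpace ℝ (Fin n)) (φ' ∘ F) x v :=
      congrArg (fun L : EuclideanSpace ℝ (Fin n) →L[ℝ] EuclideanSpace ℝ (Fin n) => L v) h3
    rw [h1, h2, mfderiv_eq_fderiv] at h4
    exact h4
  have hsurj : ∀ u, ∃ v : TangentSpace (𝓡 n) x, chartDeriv x₀ x v = u :=
    (isInvertible_mfderiv_extChartAt hxs).bijective.2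
  have hlow : ∀ u, ‖u‖ ≤ (C ^ 2 / A : ℝ) * ‖fderiv ℝ g (φ x) u‖ := by
    intro u
    obtain ⟨v, rfl⟩ := hsurj u
    rw [hderiv, div_mul_eq_mul_div, le_div_iff₀ (by exact_mod_cast hA)]
    calc ‖chartDeriv x₀ x v‖ * A ≤ C * ‖v‖ * A := by gcongr; exact hU.le_norm x hx v
      _ = C * (A * ‖v‖) := by ring
      _ ≤ C * (C * ‖chartDeriv x₁ (F x) (mfderiv (𝓡 n) (𝓡 n) F x v)‖) := by
        exact mul_le_mul_of_nonneg_left ((h v).trans (hV.norm_le _ hFx _)) C.coe_nonneg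
      _ = _ := by ring
  have hev := (hg.hasStrictFDerivAt one_ne_zero).eventually_norm_sub_le
    (k := C ^ 2 / A) (by positivity) hlow
  have hcont : Tendsto φ (𝓝 x) (𝓝 (φ x)) :=
    (continuousAt_extChartAt' hxs)
  have hW : U ∩ F ⁻¹' V ∈ 𝓝 x :=
    inter_mem (hU.isOpen.mem_nhds hx) (hF.continuous.continuousAt.preimage_mem_nhds
      (hV.isOpen.mem_nhds hFx))
  filter_upwards [(hcont.prodMap hcont).eventually hev, prod_mem_prod hW hW]
  rintro ⟨y, z⟩ hp ⟨⟨hy, hy'⟩, ⟨hz, hz'⟩⟩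
  simp only [Prod.map, g, Function.comp_apply, φ.left_inv (hU.subset_source hy),
    φ.left_inv (hU.subset_source hz)] at hp
  have hp' : ‖φ y - φ z‖ ≤ (2 * (C ^ 2 / A) : ℝ≥0) * ‖φ' (F y) - φ' (F z)‖ := by
    push_cast; exact hp
  have hp'' := enorm_le_of_norm_le hp'
  rw [← edist_eq_enorm_sub, ← edist_eq_enorm_sub] at hp''
  calc edist y z ≤ C * edist (φ y) (φ z) := hU.edist_le y hy z hz
    _ ≤ C * ((2 * (C ^ 2 / A) : ℝ≥0) * edist (φ' (F y)) (φ' (F z))) := by gcongr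
    _ ≤ C * ((2 * (C ^ 2 / A) : ℝ≥0) * (C * edist (F y) (F z))) := by
      gcongr
      exact hV.le_edist _ hy' _ hz'
    _ = (2 * C ^ 4 / A : ℝ≥0) * edist (F y) (F z) := by
      rw [← mul_assoc, ← mul_assoc, ← ENNReal.coe_mul, ← ENNReal.coe_mul]
      congr 2
      field_simp

variable [IsContinuousRiemannianBundle (EuclideanSpace ℝ (Fin n))
      (fun x : M => TangentSpace (𝓡 n) x)] [IsRiemannianManifold (𝓡 n) M]

lemma exists_isChartBound (x₀ : M) : ∃ C U, IsChartBound (n := n) x₀ C U ∧ x₀ ∈ U := by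
  obtain ⟨C₁, h₁⟩ := eventually_edist_le_edist_extChartAt (n := n) x₀
  obtain ⟨C₂, h₂⟩ := eventually_edist_extChartAt_le_edist (n := n) x₀
  obtain ⟨C₃, h₃⟩ := eventually_norm_le_chartDeriv (n := n) x₀
  obtain ⟨C₄, h₄⟩ := eventually_norm_chartDeriv_le (n := n) x₀
  obtain ⟨W, hW, hWp⟩ := mem_prod_same_iff.1 (h₁.and h₂)
  obtain ⟨U, hU, hUo, hxU⟩ := mem_nhds_iff.1 (inter_mem hW (h₃.and (h₄.and
    (extChartAt_source_mem_nhds (I := 𝓡 n) x₀))))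
  have e₁ : C₁ ≤ C₁ + C₂ + C₃ + C₄ := by rw [add_assoc, add_assoc]; exact le_self_add
  have e₂ : C₂ ≤ C₁ + C₂ + C₃ + C₄ := by
    rw [add_comm C₁, add_assoc, add_assoc]; exact le_self_add
  have e₃ : C₃ ≤ C₁ + C₂ + C₃ + C₄ := by
    rw [add_comm _ C₃, add_assoc]; exact le_self_add
  have e₄ : C₄ ≤ C₁ + C₂ + C₃ + C₄ := le_add_self
  refine ⟨C₁ + C₂ + C₃ + C₄, U, ⟨hUo, fun y hy => (hU hy).2.2.2, fun y hy z hz => ?_,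
    fun y hy z hz => ?_, fun y hy v => ?_, fun y hy v => ?_⟩, hxU⟩
  · exact (hWp (mk_mem_prod (hU hy).1 (hU hz).1)).1.trans (by gcongr)
  · exact (hWp (mk_mem_prod (hU hy).1 (hU hz).1)).2.trans (by gcongr)
  · exact ((hU hy).2.1 v).trans (by gcongr)
  · exact ((hU hy).2.2.1 v).trans (by gcongr)

variable (n M) in
lemma exists_uniform_isChartBound [CompactSpace M] :
    ∃ C > 0, ∀ x : M, ∃ x₀ U, IsChartBound (n := n) x₀ C U ∧ x ∈ U := by
  choose C U hU hxU using exists_isChartBound (n := n) (M := M)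
  obtain ⟨t, ht⟩ := CompactSpace.elim_nhds_subcover U fun x => (hU x).isOpen.mem_nhds (hxU x)
  refine ⟨t.sup C + 1, by positivity, fun x => ?_⟩
  obtain ⟨x₀, hx₀, hx⟩ := mem_iUnion₂.1 (ht.symm ▸ mem_univ x : x ∈ ⋃ x ∈ t, U x)
  exact ⟨x₀, U x₀, (hU x₀).mono ((Finset.le_sup hx₀).trans le_self_add), hx⟩

/-- The chart constant `C` does not depend on the iterate, so a large `N` outweighs the loss `2 * C
^ 4`. -/
lemma IsExpanding.locallyExpands [CompactSpace M] {f : M → M}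
    (hf : ContMDiff (𝓡 n) (𝓡 n) 1 f) (hexp : IsExpanding (n := n) f) :
    (∃ K, LocallyExpands K f) ∧ ∃ N, 0 < N ∧ LocallyExpands (1 / 2) f^[N] := by
  obtain ⟨c, hc, σ, hσ, h⟩ := hexp
  obtain ⟨C, hC, hb⟩ := exists_uniform_isChartBound n M
  have key : ∀ (N : ℕ) (A : ℝ≥0), 0 < A → A ≤ c * σ ^ N →
      LocallyExpands (2 * C ^ 4 / A) f^[N] := by
    intro N A hA hAc
    refine locallyExpands_of_forall_eventually fun x => ?_
    obtain ⟨x₀, U, hU, hx⟩ := hb x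
    obtain ⟨x₁, V, hV, hfx⟩ := hb (f^[N] x)
    refine eventually_edist_le_of_mfderiv (hf.iterate N) hC hU hV hx hfx hA fun v => ?_
    exact (mul_le_mul_of_nonneg_right hAc (norm_nonneg v)).trans (h N x v)
  constructor
  · refine ⟨_, key 1 (c * σ ^ 1).toNNReal (Real.toNNReal_pos.2 (by positivity)) ?_⟩
    exact (Real.coe_toNNReal _ (by positivity)).le
  · obtain ⟨N, hN, hN0⟩ := ((tendsto_pow_atTop_atTop_of_one_lt hσ).const_mul_atTop hc).eventually_ge_atTop
      (4 * C ^ 4 : ℝ) |>.and (eventually_gt_atTop 0) |>.exists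
    refine ⟨N, hN0, ?_⟩
    have := key N (4 * C ^ 4) (by positivity) (by push_cast; exact hN)
    convert this using 1
    field_simp
    norm_num

end LocalExpansion

/-! ### Contraction of connected sets along inverse branches -/

section Contraction

open Set Filter Metric
open scoped Topology ENNReal

variable {M : Type*} [EMetricSpace M]

lemma LocallyExpands.mono {K K' : ℝ≥0} {F : M → M} (h : LocallyExpands K F) (hK : K ≤ K') :
    LocallyExpands K' F := by
  obtain ⟨ρ, hρ, h⟩ := h
  exact ⟨ρ, hρ, fun x y hxy => (h x y hxy).trans (by gcongr)⟩

/-- Distances from `z` within `C` cannot lie strictly between `K * η` and `ρ`. By connectedness they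
cannot jump this gap, so they stay below `ρ`, where the local estimate applies. -/
lemma IsPreconnected.edist_le_of_locally_le {F : M → M} {K : ℝ≥0} {ρ η : ℝ≥0∞}
    (h : ∀ x y, edist x y < ρ → edist x y ≤ K * edist (F x) (F y)) (hη : K * η < ρ) {C : Set M}
    (hC : IsPreconnected C) (hd : ∀ z ∈ C, ∀ z' ∈ C, edist (F z) (F z') ≤ η) :
    ∀ z ∈ C, ∀ z' ∈ C, edist z z' ≤ K * edist (F z) (F z') := by
  intro z hz z' hz'
  refine h z z' (lt_of_not_ge fun hzz' => ?_)
  obtain ⟨w, hwC, hw₁, hw₂⟩ := hC {w | edist z w < ρ} {w | K * η < edist z w}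
    (isOpen_lt (by fun_prop) continuous_const) (isOpen_lt continuous_const (by fun_prop))
    (fun w _ => by
      rcases lt_or_ge (edist z w) ρ with h | h
      · exact .inl h
      · exact .inr (hη.trans_le h))
    ⟨z, hz, by simpa using hη.pos⟩ ⟨z', hz', hη.trans_le hzz'⟩
  refine (hw₂.trans_le (h z w hw₁)).not_ge ?_
  gcongr
  exact hd z hz w hwC

lemma IsPreconnected.edist_le_iterate {f : M → M} (hf : Continuous f) {K : ℝ≥0} (hK : 1 ≤ K)
    {ρ : ℝ≥0∞} (h : ∀ x y, edist x y < ρ → edist x y ≤ K * edist (f x) (f y)) (m : ℕ) {η : ℝ≥0∞}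
    (hη : K ^ m * η < ρ) {C : Set M} (hC : IsPreconnected C)
    (hd : ∀ z ∈ C, ∀ z' ∈ C, edist (f^[m] z) (f^[m] z') ≤ η) :
    ∀ z ∈ C, ∀ z' ∈ C, edist z z' ≤ K ^ m * edist (f^[m] z) (f^[m] z') := by
  have hK' : (1 : ℝ≥0∞) ≤ K := by exact_mod_cast hK
  induction m generalizing η with
  | zero => intro z _ z' _; simp
  | succ m ih =>
    have hη' : K ^ m * (K * η) < ρ := by rwa [← mul_assoc, ← pow_succ]
    have h1 : ∀ z ∈ C, ∀ z' ∈ C,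
        edist (f^[m] z) (f^[m] z') ≤ K * edist (f^[m + 1] z) (f^[m + 1] z') := by
      intro z hz z' hz'
      simp only [Function.iterate_succ_apply'] at hd ⊢
      refine IsPreconnected.edist_le_of_locally_le (η := η) h (lt_of_le_of_lt ?_ hη')
        (hC.image _ (hf.iterate m).continuousOn) ?_ _ (mem_image_of_mem _ hz) _
        (mem_image_of_mem _ hz')
      · exact le_mul_of_one_le_left zero_le (one_le_pow₀ hK')
      · rintro _ ⟨u, hu, rfl⟩ _ ⟨v, hv, rfl⟩
        exact hd u hu v hv
    intro z hz z' hz'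
    refine (ih hη' (fun u hu v hv => (h1 u hu v hv).trans ?_) z hz z' hz').trans ?_
    · gcongr
      exact hd u hu v hv
    · rw [pow_succ, mul_assoc]
      gcongr
      exact h1 z hz z' hz'

/-- Connected sets whose image under `f^i` is small are contracted by the factor `κ i` along the
corresponding branch of the inverse of `f^i`. -/
def InverseContracts (f : M → M) (κ : ℕ → ℝ≥0) (η : ℝ≥0∞) : Prop :=
  ∀ C : Set M, IsPreconnected C → ∀ i, (∀ z ∈ C, ∀ z' ∈ C, edist (f^[i] z) (f^[i] z') ≤ η) →
    ∀ z ∈ C, ∀ z' ∈ C, edist z z' ≤ κ i * edist (f^[i] z) (f^[i] z')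

lemma exists_inverseContracts {f : M → M} (hf : Continuous f) {K : ℝ≥0} (hK : LocallyExpands K f)
    {N : ℕ} (hN : 0 < N) (hfN : LocallyExpands (1 / 2) f^[N]) :
    ∃ κ : ℕ → ℝ≥0, Tendsto κ atTop (𝓝 0) ∧ ∃ η > 0, InverseContracts f κ η := by
  wlog hK1 : 1 ≤ K generalizing K
  · exact this (hK.mono (le_max_left K 1)) (le_max_right _ _)
  obtain ⟨ρ₁, hρ₁, h₁⟩ := hK
  obtain ⟨ρ₂, hρ₂, h₂⟩ := hfN
  have hKN : (K : ℝ≥0∞) ^ N ≠ 0 := pow_ne_zero _ (by simpa using (zero_lt_one.trans_le hK1).ne')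
  have hKN' : (K : ℝ≥0∞) ^ N ≠ ⊤ := ENNReal.pow_ne_top ENNReal.coe_ne_top
  -- With `K ^ N * η` below both radii, up to `N` pull-backs stay within the range of both local
  -- estimates.
  obtain ⟨η, hη0, hη⟩ := exists_between
    (ENNReal.div_pos (lt_min hρ₁ hρ₂).ne' hKN' : 0 < min ρ₁ ρ₂ / (K : ℝ≥0∞) ^ N)
  rw [ENNReal.lt_div_iff_mul_lt (.inl hKN) (.inl hKN'), mul_comm] at hη
  have hpow : ∀ r ≤ N, (K : ℝ≥0∞) ^ r ≤ (K : ℝ≥0∞) ^ N := fun r hr =>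
    pow_le_pow_right₀ (by exact_mod_cast hK1) hr
  have hbase : ∀ C : Set M, IsPreconnected C → ∀ r ≤ N,
      (∀ z ∈ C, ∀ z' ∈ C, edist (f^[r] z) (f^[r] z') ≤ η) →
      ∀ z ∈ C, ∀ z' ∈ C, edist z z' ≤ K ^ N * edist (f^[r] z) (f^[r] z') := by
    intro C hC r hr hd z hz z' hz'
    refine (IsPreconnected.edist_le_iterate hf hK1 h₁ r (lt_of_le_of_lt ?_
      (hη.trans_le (min_le_left _ _))) hC hd z hz z' hz').trans ?_
    · exact mul_le_mul_left (hpow r hr) _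
    · exact mul_le_mul_left (hpow r hr) _
  have hstep : ∀ C : Set M, IsPreconnected C →
      (∀ z ∈ C, ∀ z' ∈ C, edist (f^[N] z) (f^[N] z') ≤ η) →
      ∀ z ∈ C, ∀ z' ∈ C, edist z z' ≤ (1 / 2 : ℝ≥0) * edist (f^[N] z) (f^[N] z') := by
    intro C hC hd z hz z' hz'
    refine h₂ z z' (lt_of_le_of_lt (hbase C hC N le_rfl hd z hz z' hz') (lt_of_le_of_lt ?_
      (hη.trans_le (min_le_right _ _))))
    gcongr
    exact hd z hz z' hz'
  have hall : ∀ q, ∀ r < N, ∀ C : Set M, IsPreconnected C →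
      (∀ z ∈ C, ∀ z' ∈ C, edist (f^[N * q + r] z) (f^[N * q + r] z') ≤ η) →
      ∀ z ∈ C, ∀ z' ∈ C,
        edist z z' ≤ (K ^ N * (1 / 2) ^ q : ℝ≥0) * edist (f^[N * q + r] z) (f^[N * q + r] z') := by
    intro q r hr C hC
    induction q with
    | zero => simpa using hbase C hC r hr.le
    | succ q ih =>
      have hadd : ∀ z, f^[N * (q + 1) + r] z = f^[N] (f^[N * q + r] z) := fun z => by
        rw [← Function.iterate_add_apply]
        congr 1
        ring
      simp only [hadd]
      intro hd
      have h1 : ∀ z ∈ C, ∀ z' ∈ C, edist (f^[N * q + r] z) (f^[N * q + r] z') ≤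
          (1 / 2 : ℝ≥0) * edist (f^[N] (f^[N * q + r] z)) (f^[N] (f^[N * q + r] z')) := by
        intro z hz z' hz'
        refine hstep _ (hC.image _ (hf.iterate _).continuousOn) ?_ _ (mem_image_of_mem _ hz) _
          (mem_image_of_mem _ hz')
        rintro _ ⟨u, hu, rfl⟩ _ ⟨v, hv, rfl⟩
        exact hd u hu v hv
      intro z hz z' hz'
      refine (ih (fun u hu v hv => (h1 u hu v hv).trans ?_) z hz z' hz').trans ?_
      · refine (mul_le_of_le_one_left zero_le ?_).trans (hd u hu v hv)
        exact_mod_cast (by norm_num : (1 / 2 : ℝ≥0) ≤ 1)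
      · refine (mul_le_mul_right (h1 z hz z' hz') _).trans_eq ?_
        rw [← mul_assoc, ← ENNReal.coe_mul, pow_succ, mul_assoc]
  -- Each full block of `N` steps halves distances; the remaining `i % N` steps cost at most `K ^
  -- N`.
  refine ⟨fun i => K ^ N * (1 / 2) ^ (i / N), ?_, η, hη0, fun C hC i hd => ?_⟩
  · have h1 := (NNReal.tendsto_pow_atTop_nhds_zero_of_lt_one (r := (1 / 2 : ℝ≥0)) (by norm_num)).comp
      (Nat.tendsto_div_const_atTop hN.ne')
    simpa using h1.const_mul (K ^ N)
  · have hi := Nat.div_add_mod i N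
    have := hall (i / N) (i % N) (Nat.mod_lt _ hN) C hC
    rw [hi] at this
    exact this hd

end Contraction

/-! ### Separated points and uniform continuity -/

section Separation

open Set Filter Metric
open scoped Topology ENNReal

lemma exists_uniform_separated {M : Type*} [EMetricSpace M] [CompactSpace M]
    (hM : ∀ x : M, (𝓝[≠] x).NeBot) {η : ℝ≥0∞} (hη : 0 < η) (N : ℕ) :
    ∃ s : ℝ≥0∞, 0 < s ∧ ∀ x : M, ∃ g : Fin N → M, (∀ j, edist (g j) x < η) ∧
      ∀ i j, i ≠ j → s ≤ edist (g i) (g j) := by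
  have hη2 : 0 < η / 2 := ENNReal.half_pos hη.ne'
  have hloc : ∀ x : M, ∃ s : ℝ≥0∞, 0 < s ∧ ∃ g : Fin N → M, (∀ j, edist (g j) x < η / 2) ∧
      ∀ i j, i ≠ j → s ≤ edist (g i) (g j) := by
    intro x
    have := hM x
    have hinf : (eball x (η / 2)).Infinite := infinite_of_mem_nhds x (eball_mem_nhds x hη2)
    let g := hinf.natEmbedding
    refine ⟨(Finset.univ : Finset (Fin N)).offDiag.inf fun p => edist (g p.1 : M) (g p.2), ?_,
      fun j => g j, fun j => (g j).2, fun i j hij => ?_⟩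
    · rw [Finset.lt_inf_iff ENNReal.zero_lt_top]
      intro p hp
      rw [edist_pos]
      intro h
      exact (Finset.mem_offDiag.1 hp).2.2 (Fin.ext (g.injective (Subtype.ext h)))
    · exact Finset.inf_le (f := fun p : Fin N × Fin N => edist (g p.1 : M) (g p.2))
        (b := (i, j)) (by simpa using hij)
  choose s hs g hg hgs using hloc
  obtain ⟨t, ht⟩ := CompactSpace.elim_nhds_subcover (fun x : M => eball x (η / 2))
    fun x => eball_mem_nhds x hη2
  refine ⟨t.inf s, ?_, fun x => ?_⟩
  · rw [Finset.lt_inf_iff ENNReal.zero_lt_top]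
    exact fun x _ => hs x
  · obtain ⟨x₀, hx₀, hx⟩ := mem_iUnion₂.1 (ht.symm ▸ mem_univ x : x ∈ ⋃ x ∈ t, eball x (η / 2))
    refine ⟨g x₀, fun j => ?_, fun i j hij => (Finset.inf_le hx₀).trans (hgs x₀ i j hij)⟩
    calc edist (g x₀ j) x ≤ edist (g x₀ j) x₀ + edist x x₀ := edist_triangle_right _ _ _
      _ < η / 2 + η / 2 := ENNReal.add_lt_add (hg x₀ j) hx
      _ = η := ENNReal.add_halves η

/-- Pigeonhole: each `p i` is `τ`-close to at most one `g l`, and there are fewer indices in `S`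
than points `g l`. -/
lemma exists_forall_le_edist {M : Type*} [EMetricSpace M] {N : ℕ} {s τ : ℝ≥0∞} (hτ : τ + τ ≤ s)
    {g : Fin N → M} (hg : ∀ i j, i ≠ j → s ≤ edist (g i) (g j)) (S : Finset ℕ) (hS : S.card < N)
    (p : ℕ → M) : ∃ l, ∀ i ∈ S, τ ≤ edist (p i) (g l) := by
  by_contra! h
  choose φ hφ hφ' using h
  obtain ⟨l, -, l', -, hne, heq⟩ := Finset.exists_ne_map_eq_of_card_lt_of_maps_to
    (s := Finset.univ) (t := S) (by simpa using hS) (f := φ) (fun l _ => hφ l)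
  refine (hτ.trans (hg l l' hne)).not_gt ?_
  refine (edist_triangle_left (g l) (g l') (p (φ l))).trans_lt (ENNReal.add_lt_add (hφ' l) ?_)
  rw [heq]
  exact hφ' l'

/-- This makes visits of equal age at most `J` nearly coincide. Here `δ` depends on `J`, hence later
on `b`, which is harmless because only `a` must precede `b`. -/
lemma exists_forall_iterate_edist_le {M : Type*} [EMetricSpace M] [CompactSpace M] {f : M → M}
    (hf : Continuous f) (J : ℕ) {θ : ℝ≥0∞} (hθ : 0 < θ) :
    ∃ δ : ℝ≥0∞, 0 < δ ∧ ∀ t ≤ J, ∀ x x' y : M, edist x y ≤ δ → edist x' y ≤ δ →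
      edist (f^[t] x) (f^[t] x') ≤ θ := by
  have hU : ∀ t, ∃ δ > 0, ∀ {x x' : M}, edist x x' < δ → edist (f^[t] x) (f^[t] x') < θ :=
    fun t => EMetric.uniformContinuous_iff.1
      (CompactSpace.uniformContinuous_of_continuous (hf.iterate t)) θ hθ
  choose d hd hdf using hU
  have hpos : 0 < (Finset.range (J + 1)).inf d := by
    rw [Finset.lt_inf_iff ENNReal.zero_lt_top]
    exact fun t _ => hd t
  obtain ⟨δ, hδ, hδ'⟩ := exists_between (ENNReal.half_pos hpos.ne')
  refine ⟨δ, hδ, fun t ht x x' y hx hx' => (hdf t ?_).le⟩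
  calc edist x x' ≤ edist x y + edist x' y := edist_triangle_right _ _ _
    _ ≤ δ + δ := add_le_add hx hx'
    _ < (Finset.range (J + 1)).inf d := by
      rw [← ENNReal.add_halves ((Finset.range (J + 1)).inf d)]
      exact ENNReal.add_lt_add hδ' hδ'
    _ ≤ d t := Finset.inf_le (Finset.mem_range.2 (Nat.lt_succ_of_le ht))

lemma punctured_nhds_neBot_of_chartedSpace {n : ℕ} (hn : 1 ≤ n) {M : Type*} [TopologicalSpace M]
    [ChartedSpace (EuclideanSpace ℝ (Fin n)) M] (x : M) : (𝓝[≠] x).NeBot := by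
  have : Nonempty (Fin n) := ⟨⟨0, hn⟩⟩
  by_contra h
  have h1 : 𝓝 x = pure x := by
    rw [← isOpen_singleton_iff_nhds_eq_pure, isOpen_singleton_iff_punctured_nhds]
    exact not_neBot.1 h
  have h2 := (chartAt (EuclideanSpace ℝ (Fin n)) x).map_nhds_eq (mem_chart_source _ x)
  rw [h1, map_pure] at h2
  have h3 : 𝓝[≠] (chartAt (EuclideanSpace ℝ (Fin n)) x x) = ⊥ := by
    rw [← isOpen_singleton_iff_punctured_nhds, isOpen_singleton_iff_nhds_eq_pure]
    exact h2.symm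
  exact (inferInstance : (𝓝[≠] (chartAt (EuclideanSpace ℝ (Fin n)) x x)).NeBot).ne h3

end Separation

/-! ### Geometry of cells, visits to `y`, and Alice's reply -/

namespace InducedTiling

open Set Filter Metric
open scoped Topology ENNReal

variable {M : Type*} [EMetricSpace M] {f : M → M} {ε : ℝ}

lemma psi_eq (T : InducedTiling f ε) {n : ℕ} (hn : 1 ≤ n) {z : M} {i : Fin (T.numAtoms n)}
    (hz : z ∈ T.atom n i) : T.psi (z, n) = closure (T.atom n i) := by
  unfold psi
  congr 1
  refine Subset.antisymm (iUnion₂_subset fun j hj => ?_)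
    (subset_iUnion₂ (s := fun j (_ : z ∈ T.atom n j) => T.atom n j) i hz)
  by_cases hij : j = i
  · rw [hij]
  · exact absurd hz (disjoint_left.1 (T.disjoint_atom n hn j i hij) hj)

lemma nonempty_psi (T : InducedTiling f ε) {w : M × ℕ} (hw : w ∈ T.pairs) :
    (T.psi w).Nonempty := by
  obtain ⟨hn, i, hi⟩ := hw
  exact ⟨w.1, subset_closure (mem_iUnion₂.2 ⟨i, hi, hi⟩)⟩

lemma isClosed_psi (T : InducedTiling f ε) (w : M × ℕ) : IsClosed (T.psi w) := isClosed_closure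

lemma isPreconnected_psi (T : InducedTiling f ε) {w : M × ℕ} (hw : w ∈ T.pairs) :
    IsPreconnected (T.psi w) := by
  obtain ⟨hn, i, hi⟩ := hw
  rw [show w = (w.1, w.2) from rfl, T.psi_eq hn hi]
  exact (T.isConnected_atom _ hn i).isPreconnected.closure

lemma edist_iterate_le (T : InducedTiling f ε) (hf : Continuous f) {w : M × ℕ} (hw : w ∈ T.pairs) :
    ∀ u ∈ T.psi w, ∀ v ∈ T.psi w, edist (f^[w.2] u) (f^[w.2] v) ≤ 2 * ENNReal.ofReal ε := by
  obtain ⟨hn, i, hi⟩ := hw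
  rw [show w = (w.1, w.2) from rfl, T.psi_eq hn hi]
  obtain ⟨x, -, -, hx⟩ := T.exists_center _ hn i
  intro u hu v hv
  have hcont : Continuous (Function.uncurry fun u v => edist (f^[w.2] u) (f^[w.2] v)) :=
    ((hf.iterate _).comp continuous_fst).edist ((hf.iterate _).comp continuous_snd)
  have h := map_mem_closure₂ (u := Iic (2 * ENNReal.ofReal ε)) hcont hu hv fun a ha b hb => by
    have h1 := hx (mem_image_of_mem _ ha)
    have h2 := hx (mem_image_of_mem _ hb)
    rw [mem_closedEBall] at h1 h2
    rw [mem_Iic, two_mul]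
    exact (edist_triangle_right _ _ _).trans (add_le_add h1 h2)
  rwa [isClosed_Iic.closure_eq] at h

variable {κ : ℕ → ℝ≥0} {η : ℝ≥0∞}

lemma edist_iterate_sub_le (T : InducedTiling f ε) (hf : Continuous f)
    (hκ : InverseContracts f κ η) (hε : 2 * ENNReal.ofReal ε ≤ η) {w : M × ℕ} (hw : w ∈ T.pairs)
    {i : ℕ} (hi : i ≤ w.2) {u v : M} (hu : u ∈ T.psi w) (hv : v ∈ T.psi w) :
    edist (f^[w.2 - i] u) (f^[w.2 - i] v) ≤ κ i * edist (f^[w.2] u) (f^[w.2] v) := by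
  have hadd : ∀ z, f^[i] (f^[w.2 - i] z) = f^[w.2] z := fun z => by
    rw [← Function.iterate_add_apply, Nat.add_sub_cancel' hi]
  rw [← hadd u, ← hadd v]
  refine hκ _ ((T.isPreconnected_psi hw).image _ (hf.iterate (w.2 - i)).continuousOn) i ?_ _
    (mem_image_of_mem _ hu) _ (mem_image_of_mem _ hv)
  rintro _ ⟨a, ha, rfl⟩ _ ⟨b, hb, rfl⟩
  rw [hadd, hadd]
  exact (T.edist_iterate_le hf hw a ha b hb).trans hε

lemma edist_iterate_sub_le' (T : InducedTiling f ε) (hf : Continuous f)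
    (hκ : InverseContracts f κ η) (hε : 2 * ENNReal.ofReal ε ≤ η) {w : M × ℕ} (hw : w ∈ T.pairs)
    {i : ℕ} (hi : i ≤ w.2) {u v : M} (hu : u ∈ T.psi w) (hv : v ∈ T.psi w) :
    edist (f^[w.2 - i] u) (f^[w.2 - i] v) ≤ κ i * (2 * ENNReal.ofReal ε) := by
  refine (T.edist_iterate_sub_le hf hκ hε hw hi hu hv).trans ?_
  gcongr
  exact T.edist_iterate_le hf hw u hu v hv

lemma eventually_mul_lt (hκ0 : Tendsto κ atTop (𝓝 0)) (ε : ℝ) {s : ℝ≥0∞} (hs : 0 < s) :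
    ∃ a₀, ∀ a ≥ a₀, κ a * (2 * ENNReal.ofReal ε) < s := by
  have h : Tendsto (fun a => (κ a : ℝ≥0∞) * (2 * ENNReal.ofReal ε)) atTop (𝓝 0) := by
    have h1 : Tendsto (fun a => (κ a : ℝ≥0∞)) atTop (𝓝 0) := ENNReal.tendsto_coe.2 hκ0
    simpa using ENNReal.Tendsto.mul_const h1 (.inr (by finiteness :
      2 * ENNReal.ofReal ε ≠ ⊤))
  exact eventually_atTop.1 (h.eventually_lt_const hs)

/-- Every cell contains, `a` levels below, a cell whose image lies near any prescribed point of
some ball. -/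
lemma exists_subcell (hf : Continuous f) (hκ0 : Tendsto κ atTop (𝓝 0))
    (hκ : InverseContracts f κ η) (hε0 : 0 < ε) (hε : 2 * ENNReal.ofReal ε ≤ η) {s : ℝ≥0∞}
    (hs : 0 < s) : ∃ a₀, ∀ T : InducedTiling f ε, ∀ a ≥ a₀, ∀ w ∈ T.pairs, ∃ c,
      ∀ p, edist p c < ENNReal.ofReal (ε / 4) → ∃ w' ∈ T.pairs, w'.2 = w.2 + a ∧
        T.psi w' ⊆ T.psi w ∧ ∀ u ∈ T.psi w', edist (f^[w.2] u) p < s := by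
  have hε4 : 0 < ENNReal.ofReal (ε / 4) := ENNReal.ofReal_pos.2 (by positivity)
  obtain ⟨a₀, ha₀⟩ := eventually_mul_lt hκ0 ε (lt_min hs hε4)
  refine ⟨a₀, fun T a ha w hw => ?_⟩
  have hw0 := hw
  obtain ⟨hn, i, hi⟩ := hw
  obtain ⟨x, -, hx, -⟩ := T.exists_center _ hn i
  refine ⟨f^[w.2] x, fun p hp => ?_⟩
  have hquarter : ENNReal.ofReal (ε / 4) + ENNReal.ofReal (ε / 4) = ENNReal.ofReal (ε / 2) := by
    rw [← ENNReal.ofReal_add (by positivity) (by positivity)]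
    congr 1
    ring
  obtain ⟨x', hx'D, rfl⟩ := hx (hp.trans_le (hquarter ▸ le_self_add))
  obtain ⟨j, hj⟩ := mem_iUnion.1
    (T.cover (w.2 + a) (by omega) ▸ mem_univ x' : x' ∈ ⋃ j, closure (T.atom (w.2 + a) j))
  obtain ⟨z', hz'⟩ := (T.isConnected_atom (w.2 + a) (by omega) j).nonempty
  have hw' : (z', w.2 + a) ∈ T.pairs := ⟨by simp only; omega, j, hz'⟩
  have hpsi' := T.psi_eq (by omega) hz'
  have hpsi : T.psi w = closure (T.atom w.2 i) := T.psi_eq hn hi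
  have hclose : ∀ u ∈ T.psi (z', w.2 + a),
      edist (f^[w.2] u) (f^[w.2] x') < min s (ENNReal.ofReal (ε / 4)) := fun u hu => by
    have := T.edist_iterate_sub_le' hf hκ hε hw' (i := a) (by simp) hu (hpsi' ▸ hj)
    simp only [Nat.add_sub_cancel] at this
    exact this.trans_lt (ha₀ a ha)
  refine ⟨_, hw', rfl, ?_, fun u hu => (hclose u hu).trans_le (min_le_left _ _)⟩
  rw [hpsi]
  -- The new cell is connected, meets the open atom at `x'`, and misses its frontier: a point `v` of
  -- both closures has its image in the inner ball, hence equal to that of some `v'` in the atom,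
  -- and `f^[w.2]` is injective on `ψ w`.
  refine (IsPreconnected.subset_of_closure_inter_subset (T.isPreconnected_psi hw')
    (T.isOpen_atom _ hn i) ⟨x', hpsi' ▸ hj, hx'D⟩ ?_).trans subset_closure
  rintro v ⟨hv, hv'⟩
  obtain ⟨v', hv'D, hvv'⟩ := hx (show f^[w.2] v ∈ eball _ _ from
    (edist_triangle _ _ _).trans_lt ((ENNReal.add_lt_add
      ((hclose v hv').trans_le (min_le_right _ _)) hp).trans_eq hquarter))
  have h := T.edist_iterate_sub_le hf hκ hε hw0 le_rfl (hpsi ▸ hv)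
    (hpsi ▸ subset_closure hv'D)
  rw [hvv', edist_self, mul_zero, Nat.sub_self] at h
  rwa [show v = v' from edist_le_zero.1 h]

lemma exists_isThreshold (hf : Continuous f) (hκ0 : Tendsto κ atTop (𝓝 0))
    (hκ : InverseContracts f κ η) (hε0 : 0 < ε) (hε : 2 * ENNReal.ofReal ε ≤ η)
    (T : InducedTiling f ε) : ∃ aStar, T.IsThreshold aStar := by
  obtain ⟨a₀, ha₀⟩ := exists_subcell hf hκ0 hκ hε0 hε zero_lt_one
  refine ⟨a₀ + 1, by omega, fun w hw m hm => ?_⟩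
  obtain ⟨c, hc⟩ := ha₀ T m (by omega) w hw
  obtain ⟨w', hw', h1, h2, -⟩ := hc c (by simpa using hε0)
  refine ⟨w'.1, ?_, ?_⟩
  · rw [← h1]; exact hw'
  · rw [← h1]; exact h2

/-- The image of the cell `ψ w` under `f^(n - i)`, where `n` is the level of `w`, meets the closed
`δ`-ball around `y`. -/
def IsAlive (T : InducedTiling f ε) (δ : ℝ≥0∞) (y : M) (w : M × ℕ) (i : ℕ) : Prop :=
  i ≤ w.2 ∧ ∃ u ∈ T.psi w, edist (f^[w.2 - i] u) y ≤ δ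

/-- If the orbit of a cell comes close to `y` at three times that are not too far from each other,
then the points of its image that come from the two earlier visits are near each other. -/
lemma edist_le_of_isAlive (T : InducedTiling f ε) (hf : Continuous f)
    (hκ : InverseContracts f κ η) (hε : 2 * ENNReal.ofReal ε ≤ η) {w : M × ℕ} (hw : w ∈ T.pairs)
    {δ θ : ℝ≥0∞} {y : M} {I : ℕ} (hδ : ∀ t ≤ I, ∀ x x' : M, edist x y ≤ δ → edist x' y ≤ δ →
      edist (f^[t] x) (f^[t] x') ≤ θ) (hI : I ≤ w.2) {h h' : ℕ} (hh : h + h' ≤ I) {v u u' : M}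
    (hv : v ∈ T.psi w) (hu : u ∈ T.psi w) (hu' : u' ∈ T.psi w)
    (hvy : edist (f^[w.2 - I] v) y ≤ δ) (huy : edist (f^[w.2 - (I - h)] u) y ≤ δ)
    (huy' : edist (f^[w.2 - (I - h')] u') y ≤ δ) :
    edist (f^[w.2] u) (f^[w.2] u') ≤
      θ + κ h * (2 * ENNReal.ofReal ε) + θ + κ h' * (2 * ENNReal.ofReal ε) + θ := by
  have hadd : ∀ a b c z, a + b = c → f^[a] (f^[b] z) = f^[c] z := fun a b c z e => by
    rw [← Function.iterate_add_apply, e]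
  -- With `n = w.2`, the chain is `f^n u`, `f^(n-h) v`, `f^(n-h) u'`, `f^(n-h') u`, `f^(n-h') v`,
  -- `f^n u'`. Odd links push forward two points close to `y`, by `I - h`, `I - h - h'` and `I - h'`
  -- steps; even links compare two points of one cell at an earlier time.
  have h1 := hδ (I - h) (by omega) _ _ huy hvy
  rw [hadd _ _ w.2 _ (by omega), hadd _ _ (w.2 - h) _ (by omega)] at h1
  have h2 := T.edist_iterate_sub_le' hf hκ hε hw (i := h) (by omega) hv hu'
  have h3 := hδ (I - h - h') (by omega) _ _ huy' huy
  rw [hadd _ _ (w.2 - h) _ (by omega), hadd _ _ (w.2 - h') _ (by omega)] at h3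
  have h4 := T.edist_iterate_sub_le' hf hκ hε hw (i := h') (by omega) hu hv
  have h5 := hδ (I - h') (by omega) _ _ hvy huy'
  rw [hadd _ _ (w.2 - h') _ (by omega), hadd _ _ w.2 _ (by omega)] at h5
  refine (edist_triangle _ _ _).trans (add_le_add ?_ h5)
  refine (edist_triangle _ _ _).trans (add_le_add ?_ h4)
  refine (edist_triangle _ _ _).trans (add_le_add ?_ h3)
  exact (edist_triangle _ _ _).trans (add_le_add h1 h2)

/-- Alice's answer to `w`: no time `i > J / 2` remains alive, if none is alive beyond `J`. -/
lemma exists_reply [CompactSpace M] (hM : ∀ x : M, (𝓝[≠] x).NeBot) (hf : Continuous f)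
    (hκ0 : Tendsto κ atTop (𝓝 0)) (hκ : InverseContracts f κ η) (hε0 : 0 < ε)
    (hε : 2 * ENNReal.ofReal ε ≤ η) (T : InducedTiling f ε) (y : M) :
    ∃ a₀, ∀ a ≥ a₀, ∀ J : ℕ, ∃ δ : ℝ≥0∞, 0 < δ ∧ ∀ w ∈ T.pairs, ∃ w' ∈ T.pairs,
      w'.2 = w.2 + a ∧ T.psi w' ⊆ T.psi w ∧ ((∀ i, T.IsAlive δ y w i → i ≤ J) →
        ∀ i ≤ w.2, J < 2 * i → ∀ u ∈ T.psi w', δ < edist (f^[w.2 - i] u) y) := by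
  have hε8 : 0 < ENNReal.ofReal (ε / 8) := ENNReal.ofReal_pos.2 (by positivity)
  obtain ⟨s₂, hs₂, hsep₂⟩ := exists_uniform_separated hM hε8 2
  -- A cluster of diameter below `r` cannot be within `2r` of both of two `s₂`-separated points,
  -- since `2r + r + 2r < s₂`.
  obtain ⟨r, hr0, hr⟩ := exists_between
    (ENNReal.div_pos (lt_min hs₂ hε8).ne' (by simp) : 0 < min s₂ (ENNReal.ofReal (ε / 8)) / 5)
  have hrs : r * 5 < s₂ := (ENNReal.lt_div_iff_mul_lt (by simp) (by simp)).1
    (hr.trans_le (ENNReal.div_le_div_right (min_le_left _ _) _))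
  have hrε : r ≤ ENNReal.ofReal (ε / 8) := by
    refine hr.le.trans ((ENNReal.div_le_div_right (min_le_right _ _) _).trans ?_)
    exact ENNReal.div_le_of_le_mul (le_mul_of_one_le_right zero_le (by norm_num))
  have hrtop : r ≠ ⊤ := ne_top_of_le_ne_top ENNReal.ofReal_ne_top hrε
  have hr5 : 0 < r / 5 := ENNReal.div_pos hr0.ne' (by simp)
  -- Each of the five terms in `edist_le_of_isAlive` is to be at most `r / 5`. No constant up to
  -- `a₀` involves `J`.
  obtain ⟨m₀, hm₀⟩ := eventually_mul_lt hκ0 ε hr5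
  obtain ⟨s₃, hs₃, hsep₃⟩ := exists_uniform_separated hM hr0 (m₀ + 1)
  set τ := min r (s₃ / 2) with hτ
  have hτ0 : 0 < τ := lt_min hr0 (ENNReal.half_pos hs₃.ne')
  have hττ : τ + τ ≤ s₃ :=
    (add_le_add (min_le_right _ _) (min_le_right _ _)).trans (ENNReal.add_halves s₃).le
  obtain ⟨a₀, ha₀⟩ := exists_subcell hf hκ0 hκ hε0 hε (ENNReal.half_pos hτ0.ne')
  refine ⟨a₀, fun a ha J => ?_⟩
  -- The budget `τ` is split into `τ / 2` for the spread of visits of one age and `τ / 2` for the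
  -- distance of the new cell to its target.
  set θ := min (τ / 2) (r / 5) with hθ
  obtain ⟨δ, hδ0, hδ⟩ := exists_forall_iterate_edist_le hf J
    (lt_min (ENNReal.half_pos hτ0.ne') hr5 : 0 < θ)
  refine ⟨δ, hδ0, fun w hw => ?_⟩
  obtain ⟨c, hc⟩ := ha₀ T a ha w hw
  -- it suffices to find a target point away from the images of the visits
  suffices hp : ∃ p, edist p c < ENNReal.ofReal (ε / 4) ∧ ((∀ i, T.IsAlive δ y w i → i ≤ J) →
      ∀ i, T.IsAlive δ y w i → J < 2 * i → ∃ u ∈ T.psi w, edist (f^[w.2 - i] u) y ≤ δ ∧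
        τ ≤ edist (f^[w.2] u) p) by
    obtain ⟨p, hpc, hp⟩ := hp
    obtain ⟨w', hw', hw'2, hsub, hclose⟩ := hc p hpc
    refine ⟨w', hw', hw'2, hsub, fun hJ i hi hiJ u hu => lt_of_not_ge fun hle => ?_⟩
    have hal : T.IsAlive δ y w i := ⟨hi, u, hsub hu, hle⟩
    obtain ⟨u', hu', hu'y, hfar⟩ := hp hJ i hal hiJ
    have h1 := hδ i (hJ i hal) _ _ _ hu'y hle
    rw [← Function.iterate_add_apply, ← Function.iterate_add_apply, Nat.add_sub_cancel' hi] at h1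
    refine hfar.not_gt ((edist_triangle _ _ _).trans_lt ((ENNReal.add_lt_add_of_le_of_lt
      (ne_top_of_le_ne_top hrtop (h1.trans ((min_le_right _ _).trans (ENNReal.div_le_of_le_mul
        (le_mul_of_one_le_right zero_le (by norm_num))))))
      (h1.trans (min_le_left _ _)) (hclose u hu)).trans_eq (ENNReal.add_halves τ)))
  by_cases hex : ∃ i, T.IsAlive δ y w i ∧ J < 2 * i
  swap
  · push Not at hex
    exact ⟨c, by simpa using hε0, fun _ i hi hiJ => absurd hiJ (hex i hi).not_gt⟩
  by_cases hJ : ∀ i, T.IsAlive δ y w i → i ≤ J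
  swap
  · exact ⟨c, by simpa using hε0, fun h => absurd h hJ⟩
  obtain ⟨I, ⟨hIal, hIJ⟩, hImax⟩ : ∃ I, (T.IsAlive δ y w I ∧ J < 2 * I) ∧
      ∀ i, T.IsAlive δ y w i → i ≤ I := by
    classical
    obtain ⟨i, hi, hiJ⟩ := hex
    refine ⟨Nat.findGreatest (T.IsAlive δ y w) J, ⟨Nat.findGreatest_spec (hJ i hi) hi, ?_⟩,
      fun i hi => Nat.le_findGreatest (hJ i hi) hi⟩
    have := Nat.le_findGreatest (hJ i hi) hi
    omega
  have hchoice : ∀ i, ∃ u, T.IsAlive δ y w i → u ∈ T.psi w ∧ edist (f^[w.2 - i] u) y ≤ δ := by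
    intro i
    by_cases h : T.IsAlive δ y w i
    · exact ⟨h.2.choose, fun _ => h.2.choose_spec⟩
    · exact ⟨y, fun h' => absurd h' h⟩
  choose u hu using hchoice
  have hIle : I ≤ J := hJ I hIal
  have hnear : ∀ i i', T.IsAlive δ y w i → T.IsAlive δ y w i' → J < 2 * i → J < 2 * i' →
      i + m₀ ≤ I → i' + m₀ ≤ I → edist (f^[w.2] (u i)) (f^[w.2] (u i')) < r := by
    intro i i' hi hi' hiJ hi'J him him'
    have hθr : θ ≤ r / 5 := min_le_right _ _
    -- The condition `(I - i) + (I - i') ≤ I` holds because both ages exceed `J / 2` and `I ≤ J`.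
    have h := T.edist_le_of_isAlive hf hκ hε hw (I := I) (h := I - i) (h' := I - i') (v := u I)
      (fun t ht x x' => hδ t (ht.trans hIle) x x' y) hIal.1 (by omega)
      (hu I hIal).1 (hu i hi).1 (hu i' hi').1 (hu I hIal).2
      (by rw [Nat.sub_sub_self (by omega)]; exact (hu i hi).2)
      (by rw [Nat.sub_sub_self (by omega)]; exact (hu i' hi').2)
    have hr5top : r / 5 ≠ ⊤ := ENNReal.div_ne_top hrtop (by simp)
    have hκ1 := hm₀ (I - i) (by omega)
    have hκ2 := hm₀ (I - i') (by omega)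
    calc _ ≤ _ := h
      _ < r / 5 + r / 5 + r / 5 + r / 5 + r / 5 := by
        refine ENNReal.add_lt_add_of_lt_of_le (ne_top_of_le_ne_top hr5top hθr)
          (ENNReal.add_lt_add (ENNReal.add_lt_add_of_lt_of_le (ne_top_of_le_ne_top hr5top hθr)
            (ENNReal.add_lt_add_of_le_of_lt (ne_top_of_le_ne_top hr5top hθr) hθr hκ1) hθr) hκ2) hθr
      _ = r / 5 * 5 := by ring
      _ = r := ENNReal.div_mul_cancel (by simp) (by simp)
  obtain ⟨g₂, hg₂, hg₂'⟩ := hsep₂ c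
  -- The point `g₂ j` is at least `2r` from every visit of the cluster; moving it by less than `r`
  -- to avoid the `m₀` remaining ages stays safe.
  obtain ⟨j, hj⟩ : ∃ j, ∀ i, T.IsAlive δ y w i → J < 2 * i → i + m₀ ≤ I →
      r + r ≤ edist (f^[w.2] (u i)) (g₂ j) := by
    by_contra! hcon
    obtain ⟨i, hi, hiJ, him, hlt⟩ := hcon 0
    obtain ⟨i', hi', hi'J, him', hlt'⟩ := hcon 1
    refine (hrs.trans_le (hg₂' 0 1 (by simp))).not_gt ?_
    have h := hnear i i' hi hi' hiJ hi'J him him'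
    calc edist (g₂ 0) (g₂ 1) ≤ edist (g₂ 0) (f^[w.2] (u i)) +
          edist (f^[w.2] (u i)) (f^[w.2] (u i')) + edist (f^[w.2] (u i')) (g₂ 1) :=
          edist_triangle4 _ _ _ _
      _ < r + r + r + (r + r) := by
        rw [edist_comm (g₂ 0)]
        exact ENNReal.add_lt_add (ENNReal.add_lt_add hlt h) hlt'
      _ = r * 5 := by ring
  obtain ⟨g, hg, hg'⟩ := hsep₃ (g₂ j)
  obtain ⟨l, hl⟩ := exists_forall_le_edist hττ hg' (Finset.Ioc (I - m₀) I)
    (by rw [Nat.card_Ioc]; omega) fun i => f^[w.2] (u i)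
  refine ⟨g l, ?_, fun _ i hi hiJ => ⟨u i, (hu i hi).1, (hu i hi).2, ?_⟩⟩
  · calc edist (g l) c ≤ edist (g l) (g₂ j) + edist (g₂ j) c := edist_triangle _ _ _
      _ < ENNReal.ofReal (ε / 8) + ENNReal.ofReal (ε / 8) :=
        ENNReal.add_lt_add ((hg l).trans_le hrε) (hg₂ j)
      _ = ENNReal.ofReal (ε / 4) := by
        rw [← ENNReal.ofReal_add (by positivity) (by positivity)]
        congr 1
        ring
  · by_cases him : i + m₀ ≤ I
    · refine (min_le_left _ _).trans (le_of_not_gt fun hlt => (hj i hi hiJ him).not_gt ?_)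
      exact (edist_triangle _ (g l) _).trans_lt (ENNReal.add_lt_add hlt (hg l))
    · exact hl i (Finset.mem_Ioc.2 ⟨by omega, hImax i hi⟩)

end InducedTiling

/-! ### The winning strategy -/

namespace InducedTiling

open Set Filter Metric
open scoped Topology ENNReal

variable {M : Type*} [EMetricSpace M] {f : M → M} {ε : ℝ} {κ : ℕ → ℝ≥0} {η : ℝ≥0∞}

lemma BobLegal.mem_pairs {T : InducedTiling f ε} {b : ℕ} {strat : List (M × ℕ) → M × ℕ}
    {w : ℕ → M × ℕ} : ∀ {k : ℕ}, T.BobLegal b strat w k → w k ∈ T.pairs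
  | 0, h => h
  | _ + 1, h => h.1

/-- Decreasing cells whose levels tend to infinity intersect in exactly one point. -/
lemma exists_iInter_psi_eq_singleton [CompactSpace M] (hf : Continuous f)
    (hκ0 : Tendsto κ atTop (𝓝 0)) (hκ : InverseContracts f κ η) (hε : 2 * ENNReal.ofReal ε ≤ η)
    (T : InducedTiling f ε) {w : ℕ → M × ℕ} (hw : ∀ k, w k ∈ T.pairs)
    (hsub : ∀ k, T.psi (w (k + 1)) ⊆ T.psi (w k)) (hlevel : ∀ k, k ≤ (w k).2) :
    ∃ z, ⋂ k, T.psi (w k) = {z} := by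
  obtain ⟨z, hz⟩ := IsCompact.nonempty_iInter_of_sequence_nonempty_isCompact_isClosed
    (fun k => T.psi (w k)) hsub (fun k => T.nonempty_psi (hw k))
    (T.isClosed_psi (w 0)).isCompact (fun k => T.isClosed_psi (w k))
  refine ⟨z, Subset.antisymm (fun z' hz' => ?_) (singleton_subset_iff.2 hz)⟩
  rw [mem_iInter] at hz hz'
  by_contra hne
  obtain ⟨a, ha⟩ := eventually_mul_lt hκ0 ε (edist_pos.2 hne)
  have h := T.edist_iterate_sub_le' hf hκ hε (hw a) le_rfl (hz' a) (hz a)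
  rw [Nat.sub_self] at h
  exact h.not_gt (ha _ (hlevel a))

/-- The invariant is that at each of Bob's moves all ages of visits are at most `J`. -/
lemma isWinning_avoidingSet [CompactSpace M] (hM : ∀ x : M, (𝓝[≠] x).NeBot) (hf : Continuous f)
    (hκ0 : Tendsto κ atTop (𝓝 0)) (hκ : InverseContracts f κ η) (hε0 : 0 < ε)
    (hε : 2 * ENNReal.ofReal ε ≤ η) (T : InducedTiling f ε) (aStar : ℕ) (y : M) :
    T.IsWinning aStar (avoidingSet f y) := by
  obtain ⟨a₀, ha₀⟩ := exists_reply hM hf hκ0 hκ hε0 hε T y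
  set a := max a₀ (aStar + 1)
  have ha1 : aStar + 1 ≤ a := le_max_right _ _
  refine ⟨a, ha1, fun b hb => ?_⟩
  choose δ hδ0 hδ using ha₀ a (le_max_left _ _)
  have hreply : ∀ (J : ℕ) (w : M × ℕ), ∃ w', w ∈ T.pairs → w' ∈ T.pairs ∧
      w'.2 = w.2 + a ∧ T.psi w' ⊆ T.psi w ∧ ((∀ i, T.IsAlive (δ J) y w i → i ≤ J) →
        ∀ i ≤ w.2, J < 2 * i → ∀ u ∈ T.psi w', δ J < edist (f^[w.2 - i] u) y) := by
    intro J w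
    by_cases hw : w ∈ T.pairs
    · obtain ⟨w', h⟩ := hδ J w hw
      exact ⟨w', fun _ => h⟩
    · exact ⟨w, fun h => absurd h hw⟩
  choose reply hreply using hreply
  -- Taking `m`, the level of Bob's first cell, starts the invariant, since ages never exceed the
  -- level; `2 * (a + b)` preserves it.
  let bound : ℕ → ℕ := fun m => max m (2 * (a + b))
  -- Bob's first move fixes `J`, his last one is answered. The default `(y, 1)` is never read in a
  -- play, as the list is nonempty.
  let strat : List (M × ℕ) → M × ℕ := fun l =>
    reply (bound (l.headD (y, 1)).2) (l.getLastD (y, 1))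
  have hstrat : ∀ w k, aliceMove strat w k = reply (bound (w 0).2) (w k) := by
    intro w k
    have h1 : ((List.range (k + 1)).map w).headD (y, 1) = w 0 := by
      simp [List.range_succ_eq_map]
    have h2 : ((List.range (k + 1)).map w).getLastD (y, 1) = w k := by
      simp [List.range_succ]
    simp only [aliceMove, strat, h1, h2]
  refine ⟨strat, fun w k hw => ?_, fun w hw => ?_⟩
  · have h := hreply (bound (w 0).2) (w k) (hw k le_rfl).mem_pairs
    rw [← hstrat] at h
    exact ⟨h.1, h.2.1, h.2.2.1⟩
  set J := bound (w 0).2 with hJ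
  have hJab : 2 * (a + b) ≤ J := le_max_right _ _
  have hpairs : ∀ k, w k ∈ T.pairs := fun k => (hw k).mem_pairs
  have halice := fun k => hreply J (w k) (hpairs k)
  simp only [hJ, ← hstrat w] at halice
  rw [← hJ] at halice
  have hlevel : ∀ k, (w (k + 1)).2 = (w k).2 + a + b := fun k => by
    rw [(hw (k + 1)).2.1, (halice k).2.1]
  have hsub : ∀ k, T.psi (w (k + 1)) ⊆ T.psi (aliceMove strat w k) := fun k => (hw (k + 1)).2.2
  have hlevel' : ∀ k, k ≤ (w k).2 := by
    intro k
    induction k with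
    | zero => omega
    | succ k ih => rw [hlevel]; omega
  obtain ⟨z, hz⟩ := T.exists_iInter_psi_eq_singleton hf hκ0 hκ hε hpairs
    (fun k => (hsub k).trans (halice k).2.2.1) hlevel'
  have hzk : ∀ k, z ∈ T.psi (w k) := mem_iInter.1 (hz.symm ▸ mem_singleton z)
  have halive : ∀ k i, T.IsAlive (δ J) y (w k) i → i ≤ J := by
    intro k
    induction k with
    | zero => exact fun i hi => hi.1.trans (le_max_left _ _)
    | succ k ih =>
      rintro i ⟨hi, u, hu, huy⟩
      by_contra! hJi
      rw [hlevel] at hi huy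
      -- An age `i > J` comes from age `i - (a + b)` one turn earlier, and `2 * (i - (a + b)) > J`
      -- because `J ≥ 2 * (a + b)`; Alice's reply has removed it.
      refine ((halice k).2.2.2 ih (i - (a + b)) (by omega) (by omega) u (hsub k hu)).not_ge ?_
      rwa [show (w k).2 - (i - (a + b)) = (w k).2 + a + b - i by omega]
  refine ⟨z, fun hy => ?_, Subset.antisymm ?_ ?_⟩
  · obtain ⟨_, ⟨j, rfl⟩, hj⟩ := EMetric.mem_closure_iff.1 hy (δ J) (hδ0 J)
    -- At turn `j + J + 1` the level is at least `j + J + 1`, so a visit at time `j` has age above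
    -- `J`.
    have hle := hlevel' (j + J + 1)
    have := halive (j + J + 1) ((w (j + J + 1)).2 - j) ⟨Nat.sub_le _ _, z, hzk _, by
      rw [Nat.sub_sub_self (by omega), edist_comm]
      exact hj.le⟩
    omega
  · rw [← hz]
    exact iInter_mono fun k => inter_subset_left
  · exact singleton_subset_iff.2 (mem_iInter.2 fun k => ⟨hzk k, hsub k (hzk (k + 1))⟩)

end InducedTiling

theorem theorem1p4 {n : ℕ} (hn : 1 ≤ n) {M : Type*} [EMetricSpace M] [CompactSpace M]
    [ChartedSpace (EuclideanSpace ℝ (Fin n)) M] [IsManifold (𝓡 n) ∞ M]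
    [Bundle.RiemannianBundle (fun x : M => TangentSpace (𝓡 n) x)]
    [IsContMDiffRiemannianBundle (𝓡 n) ∞ (EuclideanSpace ℝ (Fin n))
      (fun x : M => TangentSpace (𝓡 n) x)]
    [IsRiemannianManifold (𝓡 n) M]
    (θ : ℝ≥0) (hθ : 0 < θ) (hθ1 : θ ≤ 1)
    (f : M → M) (hf : IsC1Holder (n := n) θ f) (hexp : IsExpanding (n := n) f) :
    ∃ ε₀ : ℝ, 0 < ε₀ ∧ ∀ ε : ℝ, 0 < ε → ε < ε₀ → ∀ T : InducedTiling f ε,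
      (∃ aStar : ℕ, T.IsThreshold aStar) ∧
      ∀ aStar : ℕ, T.IsThreshold aStar → ∀ y : M, T.IsWinning aStar (avoidingSet f y) := by
  have : IsManifold (𝓡 n) 1 M := IsManifold.of_le (n := ∞) (by exact_mod_cast le_top)
  have hcont : Continuous f := hf.1.continuous
  have : IsContinuousRiemannianBundle (EuclideanSpace ℝ (Fin n))
      (fun x : M => TangentSpace (𝓡 n) x) := by
    obtain ⟨g, hg, hg'⟩ := IsContMDiffRiemannianBundle.exists_contMDiff (IB := 𝓡 n) (n := ∞)
      (F := EuclideanSpace ℝ (Fin n)) (E := fun x : M => TangentSpace (𝓡 n) x)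
    exact ⟨⟨g, hg.continuous, hg'⟩⟩
  obtain ⟨⟨K, hK⟩, N, hN, hfN⟩ := hexp.locallyExpands hf.1
  obtain ⟨κ, hκ0, η, hη, hκ⟩ := exists_inverseContracts hcont hK hN hfN
  obtain ⟨r, hr0, hr⟩ := ENNReal.lt_iff_exists_nnreal_btwn.1 hη
  -- Images of cells have diameter at most `2ε`, which must not exceed `η`; `r` is a finite positive
  -- number below `η`.
  refine ⟨r / 2, by simpa using hr0, fun ε hε0 hε T => ?_⟩
  have hεη : 2 * ENNReal.ofReal ε ≤ η := by
    refine le_trans ?_ hr.le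
    rw [← ENNReal.ofReal_ofNat 2, ← ENNReal.ofReal_mul (by norm_num), ← ENNReal.ofReal_coe_nnreal]
    exact ENNReal.ofReal_le_ofReal (by linarith)
  exact ⟨T.exists_isThreshold hcont hκ0 hκ hε0 hεη, fun aStar _ y => T.isWinning_avoidingSet
    (fun x => punctured_nhds_neBot_of_chartedSpace hn x) hcont hκ0 hκ hε0 hεη aStar y⟩
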